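/- Let $\mathcal X,\mathcal Y$ be finite alphabets, let $Q(y|x)$, $x\in\mathcal X$, $y\in\mathcal Y$, be the transition probabilities of a discrete memoryless channel, and let $\star\in\mathcal X$ be a distinguished `noise' symbol. Let $$C(Q)=\sup_P\sum_{x,y}P(x)Q(y|x)\ln\frac{Q(y|x)}{\sum_{x'}P(x')Q(y|x')}$$ (supremum over probability distributions $P$ on $\mathcal X$) be the capacity of the (synchronized) channel. A block code of length $N$ with $M\ge 2$ messages consists of codewords $c^N(m)=(c_1(m),\dots,c_N(m))\in\mathcal X^N$, $m\in\{1,\dots,M\}$, and a sequential decoder $(\tau,\phi)$: with $Y_1,Y_2,\dots$ the received symbols, $\tau$ is an integer-valued stopping time of the natural filtration $(\mathcal F_n)$ of $(Y_n)$, and the declared message $\phi\in\{1,\dots,M\}$ is $\mathcal F_\tau$-measurable. For a message $m$ and a starting time $l\ge 1$, let $\mathbb P_{m,l}$ be the law under which $Y_1,Y_2,\dots$ are independent, $Y_i$ having distribution $Q(\cdot|c_{i-l+1}(m))$ for $l\le i\le l+N-1$ and $Q(\cdot|\star)$ otherwise. At the asynchronism level $A\in\{1,2,\dots\}$, which is known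 to the decoder, the error probability, the delay and the rate of the code are $$\mathbb P(\mathcal E)=\frac1{AM}\sum_{m=1}^M\sum_{l=1}^A\mathbb P_{m,l}(\phi\ne m),\qquad \mathbb E(\tau-\nu)^+=\frac1{AM}\sum_{m=1}^M\sum_{l=1}^A\mathbb E_{m,l}(\tau-l)^+,\qquad \frac{\ln M}{\mathbb E(\tau-\nu)^+}.$$ An asynchronism exponent $\alpha$ is achievable at a rate $R$ if for every $\varepsilon>0$ and all sufficiently large $N$ there is a block code of length $N$ which, at the asynchronism level $A=\lceil e^{(\alpha-\varepsilon)N}\rceil$, has rate at least $R-\varepsilon$ and error probability at most $\varepsilon$. **Corollary.** If $C(Q)>0$, then for every rate $R\in(0,C(Q))$ there is an $\alpha>0$ such that the asynchronism exponent $\alpha$ is achievable at the rate $R$. -/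

import Mathlib

open MeasureTheory ProbabilityTheory

namespace AsyncChannel

noncomputable section

/-! A discrete memoryless channel with finite input alphabet `X` and finite output alphabet `Y` is
a map `Q : X → PMF Y`; `Q x y` is the transition probability `Q(y|x)`. All logarithms are natural. -/

/-- The output distribution `(PQ)_Y(y) = ∑ x, P(x) Q(y|x)` for the input distribution `P`. -/
def outputProb {X Y : Type*} [Fintype X] (P : PMF X) (Q : X → PMF Y) (y : Y) : ℝ :=
  ∑ x, (P x).toReal * (Q x y).toReal

/-- The mutual information
`I(PQ) = ∑ x, ∑ y, P(x) Q(y|x) ln (Q(y|x) / (PQ)_Y(y))`, where terms with `P(x) Q(y|x) = 0` are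
zero (if `P(x) Q(y|x) > 0` then `(PQ)_Y(y) > 0`). -/
def mutualInformation {X Y : Type*} [Fintype X] [Fintype Y] (P : PMF X) (Q : X → PMF Y) : ℝ :=
  ∑ x, ∑ y, (P x).toReal * (Q x y).toReal *
    Real.log ((Q x y).toReal / outputProb P Q y)

/-- The capacity `C(Q)` of the synchronized channel: the supremum of `I(PQ)` over all input
distributions `P` (a supremum of a bounded set, see `bddAbove_mutualInformation`). -/
def capacity {X Y : Type*} [Fintype X] [Fintype Y] (Q : X → PMF Y) : ℝ :=
  ⨆ P : PMF X, mutualInformation P Q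

theorem bddAbove_mutualInformation {X Y : Type*} [Fintype X] [Fintype Y] (Q : X → PMF Y) :
    BddAbove (Set.range fun P : PMF X => mutualInformation P Q) := by
  refine ⟨∑ _x : X, ∑ _y : Y, (1 : ℝ), ?_⟩
  rintro _ ⟨P, rfl⟩
  refine Finset.sum_le_sum fun x _ => Finset.sum_le_sum fun y _ => ?_
  have hp : 0 ≤ (P x).toReal := ENNReal.toReal_nonneg
  have hq : 0 ≤ (Q x y).toReal := ENNReal.toReal_nonneg
  have hq1 : (Q x y).toReal ≤ 1 :=
    ENNReal.toReal_le_of_le_ofReal zero_le_one (by simpa using (Q x).coe_le_one y)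
  have hr : (P x).toReal * (Q x y).toReal ≤ outputProb P Q y :=
    Finset.single_le_sum (f := fun x => (P x).toReal * (Q x y).toReal)
      (fun _ _ => mul_nonneg ENNReal.toReal_nonneg ENNReal.toReal_nonneg) (Finset.mem_univ x)
  rcases hp.eq_or_lt with h0 | hp'
  · simp [← h0]
  rcases hq.eq_or_lt with h0 | hq'
  · simp [← h0]
  have hpq : 0 < (P x).toReal * (Q x y).toReal := mul_pos hp' hq'
  have hrpos : 0 < outputProb P Q y := hpq.trans_le hr
  have hlog : Real.log ((Q x y).toReal / outputProb P Q y) ≤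
      (Q x y).toReal / outputProb P Q y :=
    (Real.log_le_sub_one_of_pos (div_pos hq' hrpos)).trans (by linarith)
  calc (P x).toReal * (Q x y).toReal * Real.log ((Q x y).toReal / outputProb P Q y)
      ≤ (P x).toReal * (Q x y).toReal * ((Q x y).toReal / outputProb P Q y) :=
        mul_le_mul_of_nonneg_left hlog hpq.le
    _ = (Q x y).toReal * ((P x).toReal * (Q x y).toReal / outputProb P Q y) := by ring
    _ ≤ 1 * 1 := mul_le_mul hq1 ((div_le_one hrpos).2 hr) (div_nonneg hpq.le hrpos.le)
        zero_le_one
    _ = 1 := one_mul 1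

/-- A block code with `M` codewords of length `N` and its sequential decoder `(τ, φ)`. An element
`y : ℕ → Y` is a received sequence. Time starts at `0`: the observations are `y 0, y 1, …`, and
transmission starts at one of the times `0, …, A - 1`. (The times `1, 2, …` of the usual
convention are all lowered by one, which leaves `τ - ν` unchanged.) The decoding time `τ` is a
stopping time of the filtration `F` generated by the observations (`F t` is generated by
`y 0, …, y t`) and the decision rule `φ` is measurable with respect to the `σ`-algebra
`F_τ`. -/
structure Code (X Y : Type*) [MeasurableSpace Y] (M N : ℕ) where
  /-- `codeword m n` is the symbol number `n` (counted from `0`) of the codeword of message `m`. -/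
  codeword : Fin M → Fin N → X
  /-- The decoding time. -/
  τ : (ℕ → Y) → ℕ
  isStoppingTime_τ :
    IsStoppingTime (Filtration.piLE (X := fun _ : ℕ => Y)) (fun y => (τ y : WithTop ℕ))
  /-- The declared message. -/
  φ : (ℕ → Y) → Fin M
  measurable_φ : Measurable[isStoppingTime_τ.measurableSpace, ⊤] φ

/-- The channel input at time `i` when the word `c` is sent from time `l` on: the symbols of `c`
at the times `l, …, l + N - 1`, the noise symbol `star` at all other times. -/
def channelInput {X : Type*} (star : X) {N : ℕ} (c : Fin N → X) (l i : ℕ) : X :=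
  if h : l ≤ i ∧ i < l + N then c ⟨i - l, by omega⟩ else star

/-- `ℙ_{m,l}` for `c` the codeword of `m`: the law of the received sequence, whose symbols are
independent, the one at time `i` having distribution `Q(·|x)` with `x` the channel input at time
`i`. -/
def receivedLaw {X Y : Type*} [MeasurableSpace Y] (Q : X → PMF Y) (star : X) {N : ℕ}
    (c : Fin N → X) (l : ℕ) : Measure (ℕ → Y) :=
  Measure.infinitePi fun i => (Q (channelInput star c l i)).toMeasure

variable {X Y : Type*} [MeasurableSpace Y] {M N : ℕ}

/-- The average error probability
`ℙ(E) = (1/A) (1/M) ∑ m, ∑ l, ℙ_{m,l}(φ ≠ m)` at asynchronism level `A`. -/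
def Code.errorProb (κ : Code X Y M N) (Q : X → PMF Y) (star : X) (A : ℕ) : ℝ :=
  (1 / (A : ℝ)) * (1 / (M : ℝ)) * ∑ m : Fin M, ∑ l ∈ Finset.range A,
    (receivedLaw Q star (κ.codeword m) l).real {y | κ.φ y ≠ m}

/-- The average reaction delay
`𝔼(τ - ν)⁺ = (1/A) (1/M) ∑ m, ∑ l, 𝔼_{m,l}(τ - l)⁺` at asynchronism level `A`, a number in
`[0, ∞]`; the subtraction of natural numbers `τ y - l` is the positive part. -/
def Code.delay (κ : Code X Y M N) (Q : X → PMF Y) (star : X) (A : ℕ) : ENNReal :=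
  (A : ENNReal)⁻¹ * (M : ENNReal)⁻¹ * ∑ m : Fin M, ∑ l ∈ Finset.range A,
    ∫⁻ y, ((κ.τ y - l : ℕ) : ENNReal) ∂(receivedLaw Q star (κ.codeword m) l)

/-- The rate `ln M / 𝔼(τ - ν)⁺`, a number in `[0, ∞]` (for `M ≥ 2` it is `∞` if the delay is `0`,
and `0` if the delay is `∞`). -/
def Code.rate (κ : Code X Y M N) (Q : X → PMF Y) (star : X) (A : ℕ) : ENNReal :=
  ENNReal.ofReal (Real.log M) / κ.delay Q star A

/-- The asynchronism exponent `α` is achievable at rate `R`: for every `ε > 0` and every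
sufficiently large `N` there is a block code with at least two codewords of length `N` which, at
asynchronism level `A = e^{(α - ε) N}` (rounded up to a positive integer), has rate at least
`R - ε` and error probability at most `ε`. -/
def Achievable (Q : X → PMF Y) (star : X) (α R : ℝ) : Prop :=
  ∀ ε : ℝ, 0 < ε → ∃ N₀ : ℕ, ∀ N : ℕ, N₀ ≤ N →
    ∃ M : ℕ, 2 ≤ M ∧ ∃ κ : Code X Y M N,
      ENNReal.ofReal (R - ε) ≤ κ.rate Q star ⌈Real.exp ((α - ε) * N)⌉₊ ∧
      κ.errorProb Q star ⌈Real.exp ((α - ε) * N)⌉₊ ≤ ε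

end

end AsyncChannel

namespace AsyncChannel

/-! The proof is by random coding. Pick `P` and `γ` with `R < γ < I(PQ)`, draw about `e^{RN}`
codewords with i.i.d. symbols of law `P`, and let the decoder stop as soon as the last `N` outputs
have density-ratio product at least `e^{γN}` for some codeword. A wrong codeword is independent of
the outputs, whatever mixture of noise and codeword fills the window, so Markov's inequality bounds
its acceptance by `e^{-γN}` (`lintegral_acceptSet_le`). Accepting the right message too early is no
error and only shortens `(τ - l)⁺`. The sent codeword is missed in its own window with probability
at most `ρ^N` (`lintegral_compl_acceptSet_le`), and `ρ < 1` because `γ < I(PQ)`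
(`exists_exponent_lt_one`). The union bound over `M A` wrong pairs, and the delay `A + N` charged to
a miss, cost only a factor of order `e^{αN}` beyond `e^{RN}`, which is absorbed when `α` is small.
Hence error and excess delay over `N` both vanish, and the rate tends to at least `R`. -/

/-! ### Sequential decoders from acceptance tests -/

/-- On a finite discrete alphabet, an event that depends only on the coordinates up to `i` is
measurable at time `i`. -/
theorem measurableSet_piLE_of_forall_eq {Y : Type*} [Finite Y] [MeasurableSpace Y]
    [DiscreteMeasurableSpace Y] {i : ℕ} {B : Set (ℕ → Y)}
    (hB : ∀ y y' : ℕ → Y, (∀ k ≤ i, y k = y' k) → y ∈ B → y' ∈ B) :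
    MeasurableSet[Filtration.piLE (X := fun _ : ℕ => Y) i] B := by
  have hfin : Finite (Set.Iic i) := (Set.finite_Iic i).to_subtype
  refine ⟨Preorder.restrictLe (π := fun _ : ℕ => Y) i '' B,
    Set.Finite.measurableSet (Set.toFinite _), ?_⟩
  refine Set.Subset.antisymm ?_ (Set.subset_preimage_image _ _)
  rintro y ⟨y', hy', h⟩
  exact hB y' y (fun k hk => congrFun h ⟨k, hk⟩) hy'

/-- The sequential decoder attached to a nonanticipating family of acceptance tests: it stops as
soon as some message is accepted, at time `T` at the latest, and declares an accepted message. -/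
theorem exists_code_of_tests {X Y : Type*} [Finite Y] [MeasurableSpace Y]
    [DiscreteMeasurableSpace Y] {M N : ℕ} (hM : 0 < M) (c : Fin M → Fin N → X)
    (test : ℕ → Fin M → Set (ℕ → Y))
    (htest : ∀ n m (y y' : ℕ → Y), (∀ k ≤ n, y k = y' k) → y ∈ test n m → y' ∈ test n m)
    (T : ℕ) :
    ∃ κ : Code X Y M N, κ.codeword = c ∧ (∀ y, κ.τ y ≤ T) ∧
      (∀ y n m, y ∈ test n m → κ.τ y ≤ n) ∧
      ∀ y, κ.τ y < T → y ∈ test (κ.τ y) (κ.φ y) := by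
  classical
  have hex : ∀ y : ℕ → Y, ∃ n, (∃ m, y ∈ test n m) ∨ n = T := fun y => ⟨T, Or.inr rfl⟩
  let τ : (ℕ → Y) → ℕ := fun y => Nat.find (hex y)
  -- The choice depends only on the set of accepted messages, so outputs agreeing up to `τ` get the
  -- same decision. The default is used only at a forced stop.
  let pick : Set (Fin M) → Fin M := fun S => if h : S.Nonempty then h.choose else ⟨0, hM⟩
  let φ : (ℕ → Y) → Fin M := fun y => pick {m | y ∈ test (τ y) m}
  have hiff : ∀ n m (y y' : ℕ → Y), (∀ k ≤ n, y k = y' k) → (y ∈ test n m ↔ y' ∈ test n m) :=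
    fun n m y y' h => ⟨htest n m y y' h, htest n m y' y fun k hk => (h k hk).symm⟩
  have hτ : ∀ (y y' : ℕ → Y) i, (∀ k ≤ i, y k = y' k) → τ y ≤ i → τ y' = τ y := by
    intro y y' i h hi
    have h' : ∀ n ≤ i, ∀ m, y ∈ test n m ↔ y' ∈ test n m :=
      fun n hn m => hiff n m y y' fun k hk => h k (hk.trans hn)
    refine (Nat.find_eq_iff _).2 ⟨?_, ?_⟩
    · exact (Nat.find_spec (hex y)).imp (fun ⟨m, hm⟩ => ⟨m, (h' _ hi m).1 hm⟩) id
    · intro n hn hc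
      exact Nat.find_min (hex y) hn
        (hc.imp (fun ⟨m, hm⟩ => ⟨m, (h' n (hn.le.trans hi) m).2 hm⟩) id)
  have hφ : ∀ (y y' : ℕ → Y) i, (∀ k ≤ i, y k = y' k) → τ y ≤ i → φ y' = φ y := by
    intro y y' i h hi
    have : {m | y' ∈ test (τ y') m} = {m | y ∈ test (τ y) m} := by
      ext m
      rw [Set.mem_ofPred_eq, Set.mem_ofPred_eq, hτ y y' i h hi]
      exact (hiff _ m y y' fun k hk => h k (hk.trans hi)).symm
    exact congrArg pick this
  have hτT : ∀ y, τ y ≤ T := fun y => Nat.find_min' _ (Or.inr rfl)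
  have hτ_stopping : IsStoppingTime (Filtration.piLE (X := fun _ : ℕ => Y))
      (fun y => (τ y : WithTop ℕ)) := by
    intro i
    refine measurableSet_piLE_of_forall_eq fun y y' h hy => ?_
    have hy : τ y ≤ i := by simpa using hy
    have : τ y' ≤ i := (hτ y y' i h hy).trans_le hy
    simpa using this
  have hpre : ∀ (s : Set (Fin M)) (i : ℕ), MeasurableSet[Filtration.piLE (X := fun _ : ℕ => Y) i]
      (φ ⁻¹' s ∩ {y | (τ y : WithTop ℕ) ≤ i}) := by
    intro s i
    refine measurableSet_piLE_of_forall_eq ?_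
    rintro y y' h ⟨hs, hi⟩
    have hi : τ y ≤ i := by simpa using hi
    refine ⟨?_, ?_⟩
    · rw [Set.mem_preimage, hφ y y' i h hi]; exact hs
    · have : τ y' ≤ i := (hτ y y' i h hi).trans_le hi
      simpa using this
  refine ⟨⟨c, τ, hτ_stopping, φ, fun s _ => ⟨?_, hpre s⟩⟩, rfl, hτT, ?_, ?_⟩
  -- Since `τ ≤ T`, the whole decision is already known at time `T`.
  · have h : φ ⁻¹' s = φ ⁻¹' s ∩ {y | (τ y : WithTop ℕ) ≤ (T : ℕ)} := by
      refine (Set.inter_eq_left.2 fun y _ => ?_).symm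
      simpa using hτT y
    rw [h]
    exact le_iSup (fun t => Filtration.piLE (X := fun _ : ℕ => Y) t) T _ (hpre s T)
  · exact fun y n m hm => Nat.find_min' _ (Or.inl ⟨m, hm⟩)
  · intro y hy
    have hne : {m | y ∈ test (τ y) m}.Nonempty :=
      (Nat.find_spec (hex y)).resolve_right (Nat.ne_of_lt hy)
    have : pick {m | y ∈ test (τ y) m} ∈ {m | y ∈ test (τ y) m} := by
      simp only [pick, dif_pos hne]
      exact hne.choose_spec
    exact this

/-! ### The threshold test for a random codeword -/

instance isProbabilityMeasure_receivedLaw {X Y : Type*} [MeasurableSpace Y] (Q : X → PMF Y)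
    (star : X) {N : ℕ} (c : Fin N → X) (l : ℕ) :
    IsProbabilityMeasure (receivedLaw Q star c l) := by
  unfold receivedLaw; infer_instance

theorem lintegral_infinitePi_prod {ι κ Ω : Type*} [Fintype κ] [MeasurableSpace Ω]
    (μ : ι → Measure Ω) [∀ i, IsProbabilityMeasure (μ i)] {e : κ → ι}
    (he : Function.Injective e) {g : κ → Ω → ENNReal} (hg : ∀ j, Measurable (g j)) :
    ∫⁻ y, ∏ j, g j (y (e j)) ∂(Measure.infinitePi μ) = ∏ j, ∫⁻ ω, g j ω ∂(μ (e j)) := by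
  have h1 : iIndepFun (fun j (y : ι → Ω) => y (e j)) (Measure.infinitePi μ) :=
    (iIndepFun_infinitePi (X := fun _ ω => ω) fun _ => measurable_id).precomp he
  have h2 : iIndepFun (fun j (y : ι → Ω) => g j (y (e j))) (Measure.infinitePi μ) :=
    h1.comp _ hg
  rw [lintegral_prod_eq_prod_lintegral_of_indepFun Finset.univ _ h2
    fun j => (hg j).comp (measurable_pi_apply _)]
  refine Finset.prod_congr rfl fun j _ => ?_
  rw [← Measure.infinitePi_map_eval μ (e j), lintegral_map (hg j) (measurable_pi_apply _)]

/-- The density ratio `Q(y|x) / (PQ)_Y(y)`. -/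
noncomputable def densityRatio {X Y : Type*} [Fintype X] (P : PMF X) (Q : X → PMF Y) (x : X)
    (y : Y) : NNReal :=
  (Q x y / ∑ x', P x' * Q x' y).toNNReal

/-- This pointwise bound is why no assumption on the output law is needed for false acceptances.
Where `(PQ)_Y(y) = 0`, a quotient `⊤` becomes `0` under `toNNReal`, which only lowers the sum. -/
theorem sum_mul_densityRatio_le_one {X Y : Type*} [Fintype X] (P : PMF X) (Q : X → PMF Y) (y : Y) :
    ∑ x, P x * (densityRatio P Q x y : ENNReal) ≤ 1 := by
  calc ∑ x, P x * (densityRatio P Q x y : ENNReal)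
      ≤ ∑ x, P x * (Q x y / ∑ x', P x' * Q x' y) :=
        Finset.sum_le_sum fun x _ => mul_le_mul_right ENNReal.coe_toNNReal_le_self _
    _ = (∑ x, P x * Q x y) / ∑ x', P x' * Q x' y := by
        simp only [div_eq_mul_inv, ← mul_assoc, Finset.sum_mul]
    _ ≤ 1 := ENNReal.div_self_le_one

/-- The outputs in the window of length `N` that starts at time `s` pass the threshold test for the
word `w`. -/
def acceptSet {X Y : Type*} {N : ℕ} (f : X → Y → NNReal) (θ : ENNReal) (w : Fin N → X) (s : ℕ) :
    Set (ℕ → Y) :=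
  {y | θ ≤ ∏ j : Fin N, (f (w j) (y (s + j)) : ENNReal)}

section

variable {X Y : Type*} [Fintype X] [MeasurableSpace X] [DiscreteMeasurableSpace X]
  [Fintype Y] [MeasurableSpace Y] [DiscreteMeasurableSpace Y] {N : ℕ}

theorem lintegral_toMeasure_eq_sum (P : PMF X) (g : X → ENNReal) :
    ∫⁻ x, g x ∂P.toMeasure = ∑ x, P x * g x := by
  rw [lintegral_fintype]
  exact Finset.sum_congr rfl fun x _ => by
    rw [PMF.toMeasure_apply_singleton _ _ (measurableSet_singleton x), mul_comm]

/-- The law of a random codeword with independent symbols of distribution `P`. -/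
noncomputable def wordLaw (P : PMF X) (N : ℕ) : Measure (Fin N → X) :=
  Measure.infinitePi fun _ => P.toMeasure

instance (P : PMF X) (N : ℕ) : IsProbabilityMeasure (wordLaw P N) := by
  unfold wordLaw; infer_instance

theorem lintegral_wordLaw_prod (P : PMF X) (g : Fin N → X → ENNReal) :
    ∫⁻ w, ∏ j, g j (w j) ∂(wordLaw P N) = ∏ j, ∑ x, P x * g j x := by
  exact (lintegral_infinitePi_prod (fun _ : Fin N => P.toMeasure) (e := id)
    Function.injective_id fun j => measurable_of_countable (g j)).trans
    (Finset.prod_congr rfl fun j _ => lintegral_toMeasure_eq_sum P _)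

theorem measurable_prod_window {X Y : Type*} [Fintype Y] [MeasurableSpace Y]
    [DiscreteMeasurableSpace Y] {N : ℕ} (f : X → Y → ENNReal) (w : Fin N → X) (s : ℕ) :
    Measurable fun y : ℕ → Y => ∏ j : Fin N, f (w j) (y (s + j)) :=
  Finset.measurable_prod _ fun j _ =>
    (measurable_of_countable (f (w j))).comp (measurable_pi_apply _)

/-- A random word is accepted on an unrelated output window with probability at most `1 / θ`. -/
theorem lintegral_acceptSet_le (P : PMF X) (Q : X → PMF Y) (θ : ENNReal) (hθ : θ ≠ 0)
    (hθ' : θ ≠ ⊤) (s : ℕ) (L : Measure (ℕ → Y)) [IsProbabilityMeasure L] :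
    ∫⁻ w : Fin N → X, L (acceptSet (densityRatio P Q) θ w s) ∂(wordLaw P N) ≤ θ⁻¹ := by
  set f : X → Y → ENNReal := fun x y => densityRatio P Q x y
  have h1 : ∀ w : Fin N → X, L (acceptSet (densityRatio P Q) θ w s) ≤
      θ⁻¹ * ∫⁻ y, ∏ j : Fin N, f (w j) (y (s + j)) ∂L := fun w => by
    rw [mul_comm, ← div_eq_mul_inv]
    exact meas_ge_le_lintegral_div (measurable_prod_window f w s).aemeasurable hθ hθ'
  refine (lintegral_mono h1).trans ?_
  rw [lintegral_const_mul _ (measurable_of_countable _)]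
  refine mul_le_of_le_one_right' ?_
  -- With the outputs fixed, averaging over the word factorizes into sums that are each at most `1`.
  rw [lintegral_lintegral_swap]
  · refine (lintegral_mono (g := fun _ => 1) fun y => ?_).trans (by simp)
    rw [lintegral_wordLaw_prod P fun j x => f x (y (s + j))]
    exact Finset.prod_le_one' fun j _ => sum_mul_densityRatio_le_one P Q _
  · exact (measurable_from_prod_countable_right fun w =>
      measurable_prod_window f w s).aemeasurable

/-- Chernoff bound: a random word is missed in its own output window with probability at most
`(ρ θ ^ t) ^ N`. -/
theorem lintegral_compl_acceptSet_le (P : PMF X) (Q : X → PMF Y) (star : X) (θ : ENNReal)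
    (hθ : θ ≠ 0) (hθ' : θ ≠ ⊤) {t : ℝ} (ht : 0 < t) (l : ℕ) (f : X → Y → NNReal) :
    ∫⁻ w : Fin N → X, receivedLaw Q star w l (acceptSet f (θ ^ N) w l)ᶜ ∂(wordLaw P N) ≤
      (θ ^ t * ∑ x, P x * ∑ y, Q x y * (f x y : ENNReal) ^ (-t)) ^ N := by
  set g : X → Y → ENNReal := fun x y => (f x y : ENNReal) ^ (-t)
  have hprod : ∀ (w : Fin N → X) (y : ℕ → Y),
      ∏ j : Fin N, g (w j) (y (l + j)) = (∏ j : Fin N, (f (w j) (y (l + j)) : ENNReal)) ^ (-t) := by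
    intro w y
    -- Finite factors are essential: a negative power does not distribute over `0 * ⊤`.
    rw [ENNReal.prod_rpow_of_ne_top]
    simp
  have h1 : ∀ w : Fin N → X, receivedLaw Q star w l (acceptSet f (θ ^ N) w l)ᶜ ≤
      (θ ^ t) ^ N * ∏ j, ∑ y, Q (w j) y * g (w j) y := fun w => by
    have h2 : (acceptSet f (θ ^ N) w l)ᶜ ⊆
        {y | ((θ ^ N) ^ t)⁻¹ ≤ ∏ j : Fin N, g (w j) (y (l + j))} := by
      intro y hy
      have hy : ∏ j : Fin N, (f (w j) (y (l + j)) : ENNReal) < θ ^ N := not_le.1 hy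
      rw [Set.mem_ofPred_eq, hprod, ENNReal.rpow_neg, ENNReal.inv_le_inv]
      exact ENNReal.rpow_le_rpow hy.le ht.le
    have h3 : (θ ^ N) ^ t = (θ ^ t) ^ N := by
      rw [← ENNReal.rpow_natCast, ← ENNReal.rpow_natCast, ← ENNReal.rpow_mul, ← ENNReal.rpow_mul,
        mul_comm]
    have hne : θ ^ t ≠ 0 := by simp [ENNReal.rpow_eq_zero_iff, hθ, hθ']
    have hnt : θ ^ t ≠ ⊤ := ENNReal.rpow_ne_top_of_nonneg ht.le hθ'
    refine (measure_mono h2).trans ?_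
    refine (meas_ge_le_lintegral_div (measurable_prod_window g w l).aemeasurable ?_ ?_).trans ?_
    · rw [h3]; exact ENNReal.inv_ne_zero.2 (ENNReal.pow_ne_top hnt)
    · rw [h3]; exact ENNReal.inv_ne_top.2 (pow_ne_zero _ hne)
    rw [div_eq_mul_inv, inv_inv, mul_comm, h3]
    refine mul_le_mul_right (le_of_eq ?_) _
    have he : Function.Injective fun j : Fin N => l + (j : ℕ) := fun i j h => by
      ext; exact Nat.add_left_cancel h
    rw [receivedLaw, lintegral_infinitePi_prod
      (fun i => (Q (channelInput star w l i)).toMeasure) he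
      fun j => measurable_of_countable (g (w j))]
    refine Finset.prod_congr rfl fun j _ => ?_
    have : channelInput star w l (l + j) = w j := by
      have hj := j.2
      simp [channelInput]
    rw [lintegral_toMeasure_eq_sum, this]
  refine (lintegral_mono h1).trans ?_
  rw [lintegral_const_mul _ (measurable_of_countable _),
    lintegral_wordLaw_prod P fun _ x => ∑ y, Q x y * g x y, mul_pow]
  simp [g]

end

/-! ### Existence of a good codebook and its decoder -/

/-- The total weight, over all messages and starting times, of the wrong acceptances and of the
missed transmissions, a miss being weighted by the longest possible delay `A + N`. -/
noncomputable def badWeight {X Y : Type*} [MeasurableSpace Y] {M N : ℕ} (Q : X → PMF Y) (star : X)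
    (f : X → Y → NNReal) (θ : ENNReal) (A : ℕ) (c : Fin M → Fin N → X) : ENNReal :=
  ∑ m, ∑ l ∈ Finset.range A,
    (∑ m' ∈ Finset.univ.erase m, ∑ s ∈ Finset.range A,
        receivedLaw Q star (c m) l (acceptSet f θ (c m') s) +
      (A + N : ℕ) * receivedLaw Q star (c m) l (acceptSet f θ (c m) l)ᶜ)

/-- First-moment method: some codebook does no worse than the average over independent words of law
`wordLaw P N`. -/
theorem exists_badWeight_le {X Y : Type*} [Fintype X] [Fintype Y] [MeasurableSpace Y]
    [DiscreteMeasurableSpace Y] (P : PMF X) (Q : X → PMF Y) (star : X) {θ : ENNReal}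
    (hθ : θ ≠ 0) (hθ' : θ ≠ ⊤) {t : ℝ} (ht : 0 < t) (M N A : ℕ) :
    ∃ c : Fin M → Fin N → X, badWeight Q star (densityRatio P Q) (θ ^ N) A c ≤
      M * (A * (M * (A * (θ ^ N)⁻¹) + (A + N : ℕ) *
        (θ ^ t * ∑ x, P x * ∑ y, Q x y * (densityRatio P Q x y : ENNReal) ^ (-t)) ^ N)) := by
  let _ : MeasurableSpace X := ⊤
  have : DiscreteMeasurableSpace X := ⟨fun _ => trivial⟩
  set f := densityRatio P Q
  set μ : Measure (Fin M → Fin N → X) := Measure.infinitePi fun _ => wordLaw P N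
  obtain ⟨c, hc⟩ := exists_le_lintegral (μ := μ)
    (f := badWeight Q star f (θ ^ N) A) (measurable_of_countable _).aemeasurable
  refine ⟨c, hc.trans ?_⟩
  have hwrong : ∀ m, ∀ m' ∈ Finset.univ.erase m, ∀ l s,
      ∫⁻ c, receivedLaw Q star (c m) l (acceptSet f (θ ^ N) (c m') s) ∂μ ≤ (θ ^ N)⁻¹ := by
    intro m m' hm' l s
    have hne : m ≠ m' := (Finset.ne_of_mem_erase hm').symm
    -- Distinct messages have independent words, so `c m'` can be averaged with the output law of `c
    -- m` fixed.
    have hmap : Measure.map (fun c : Fin M → Fin N → X => (c m, c m')) μ =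
        (wordLaw P N).prod (wordLaw P N) :=
      Measure.infinitePi_map_eval_prod (P := fun _ : Fin M => wordLaw P N) hne
    have h1 : ∫⁻ c, receivedLaw Q star (c m) l (acceptSet f (θ ^ N) (c m') s) ∂μ =
        ∫⁻ w, receivedLaw Q star w.1 l (acceptSet f (θ ^ N) w.2 s)
          ∂((wordLaw P N).prod (wordLaw P N)) := by
      rw [← hmap, lintegral_map (measurable_of_countable _) (measurable_of_countable _)]
    rw [h1, lintegral_prod _ (measurable_of_countable _).aemeasurable]
    refine (lintegral_mono (g := fun _ => (θ ^ N)⁻¹) fun w => ?_).trans (by simp)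
    exact lintegral_acceptSet_le P Q _ (pow_ne_zero _ hθ) (ENNReal.pow_ne_top hθ') s
      (receivedLaw Q star w l)
  have hmiss : ∀ m l, ∫⁻ c, receivedLaw Q star (c m) l (acceptSet f (θ ^ N) (c m) l)ᶜ ∂μ ≤
      (θ ^ t * ∑ x, P x * ∑ y, Q x y * (f x y : ENNReal) ^ (-t)) ^ N := by
    intro m l
    have hmap : Measure.map (fun c : Fin M → Fin N → X => c m) μ = wordLaw P N :=
      
      Measure.infinitePi_map_eval (fun _ : Fin M => wordLaw P N) m
    have h1 : ∫⁻ c, receivedLaw Q star (c m) l (acceptSet f (θ ^ N) (c m) l)ᶜ ∂μ =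
        ∫⁻ w, receivedLaw Q star w l (acceptSet f (θ ^ N) w l)ᶜ ∂(wordLaw P N) := by
      rw [← hmap, lintegral_map (measurable_of_countable _) (measurable_of_countable _)]
    rw [h1]
    exact lintegral_compl_acceptSet_le P Q star θ hθ hθ' ht l f
  set ρ := θ ^ t * ∑ x, P x * ∑ y, Q x y * (f x y : ENNReal) ^ (-t)
  calc ∫⁻ c, badWeight Q star f (θ ^ N) A c ∂μ
      = ∑ m, ∑ l ∈ Finset.range A,
        (∑ m' ∈ Finset.univ.erase m, ∑ s ∈ Finset.range A,
          ∫⁻ c, receivedLaw Q star (c m) l (acceptSet f (θ ^ N) (c m') s) ∂μ +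
        (A + N : ℕ) * ∫⁻ c, receivedLaw Q star (c m) l (acceptSet f (θ ^ N) (c m) l)ᶜ ∂μ) := by
        simp only [badWeight]
        rw [lintegral_finsetSum _ fun _ _ => measurable_of_countable _]
        refine Finset.sum_congr rfl fun m _ => ?_
        rw [lintegral_finsetSum _ fun _ _ => measurable_of_countable _]
        refine Finset.sum_congr rfl fun l _ => ?_
        rw [lintegral_add_left (measurable_of_countable _),
          lintegral_const_mul _ (measurable_of_countable _),
          lintegral_finsetSum _ fun _ _ => measurable_of_countable _]
        congr 1
        refine Finset.sum_congr rfl fun m' _ => ?_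
        rw [lintegral_finsetSum _ fun _ _ => measurable_of_countable _]
    _ ≤ ∑ _m : Fin M, ∑ _l ∈ Finset.range A,
        (∑ _m' : Fin M, ∑ _s ∈ Finset.range A, (θ ^ N)⁻¹ + (A + N : ℕ) * ρ ^ N) := by
        refine Finset.sum_le_sum fun m _ => Finset.sum_le_sum fun l _ => add_le_add ?_ ?_
        · refine (Finset.sum_le_sum fun m' hm' => Finset.sum_le_sum fun s _ =>
            hwrong m m' hm' l s).trans ?_
          exact Finset.sum_le_sum_of_subset (Finset.erase_subset _ _)
        · exact mul_le_mul_right (hmiss m l) _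
    _ = _ := by simp [mul_add]

/-- One quantity controls both criteria: an error forces a wrong acceptance or a miss, and the delay
is at most `N` without a miss and at most `A + N` with one. -/
theorem exists_code_of_badWeight_le {X Y : Type*} [Finite Y] [MeasurableSpace Y]
    [DiscreteMeasurableSpace Y] {M N A : ℕ} (hM : 0 < M) (hN : 0 < N) (hA : 0 < A)
    (Q : X → PMF Y) (star : X) (f : X → Y → NNReal) (θ : ENNReal) (c : Fin M → Fin N → X)
    {η : ENNReal} (hη : η ≠ ⊤) (h : badWeight Q star f θ A c ≤ M * (A * η)) :
    ∃ κ : Code X Y M N, κ.errorProb Q star A ≤ η.toReal ∧ κ.delay Q star A ≤ N + η := by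
  obtain ⟨κ, hκc, hκT, hκle, hκtest⟩ := exists_code_of_tests hM c
    -- At time `n` the last full window starts at `s = n + 1 - N`; there is none while `n + 1 < N`.
    (fun n m => {y | ∃ s, s + N = n + 1 ∧ y ∈ acceptSet f θ (c m) s}) (by
      rintro n m y y' hyy ⟨s, hs, hy⟩
      refine ⟨s, hs, ?_⟩
      have : ∏ j : Fin N, (f (c m j) (y' (s + j)) : ENNReal) =
          ∏ j : Fin N, (f (c m j) (y (s + j)) : ENNReal) :=
        Finset.prod_congr rfl fun j _ => by rw [hyy (s + j) (by omega)]
      exact (le_of_le_of_eq hy this.symm)) (A + N)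
  have hacc : ∀ y m l, y ∈ acceptSet f θ (c m) l → κ.τ y + 1 ≤ l + N := by
    intro y m l hy
    have := hκle y (l + N - 1) m ⟨l, by omega, hy⟩
    omega
  have herr : ∀ m, ∀ l < A, {y | κ.φ y ≠ m} ⊆
      (⋃ m' ∈ Finset.univ.erase m, ⋃ s ∈ Finset.range A, acceptSet f θ (c m') s) ∪
        (acceptSet f θ (c m) l)ᶜ := by
    intro m l hl y hy
    by_cases hml : y ∈ acceptSet f θ (c m) l
    · left
      have hτ := hacc y m l hml
      -- The true window stops the decoder by `l + N - 1 < A + N`, so the stop is not forced and the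
      -- accepted window starts at `s ≤ l < A`.
      obtain ⟨s, hs, hys⟩ := hκtest y (by omega)
      simp only [Set.mem_iUnion]
      exact ⟨κ.φ y, Finset.mem_erase.2 ⟨hy, Finset.mem_univ _⟩, s,
        Finset.mem_range.2 (by omega), hys⟩
    · exact Or.inr hml
  have hM0 : (M : ENNReal) ≠ 0 := by exact_mod_cast hM.ne'
  have hA0 : (A : ENNReal) ≠ 0 := by exact_mod_cast hA.ne'
  have hMt : (M : ENNReal) ≠ ⊤ := ENNReal.natCast_ne_top M
  have hAt : (A : ENNReal) ≠ ⊤ := ENNReal.natCast_ne_top A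
  refine ⟨κ, ?_, ?_⟩
  · have hsum : ∑ m : Fin M, ∑ l ∈ Finset.range A,
        receivedLaw Q star (κ.codeword m) l {y | κ.φ y ≠ m} ≤ M * (A * η) := by
      refine le_trans (Finset.sum_le_sum fun m _ => Finset.sum_le_sum fun l hl => ?_) h
      rw [hκc]
      refine (measure_mono (herr m l (Finset.mem_range.1 hl))).trans
        ((measure_union_le _ _).trans (add_le_add ?_ ?_))
      · refine (measure_biUnion_finset_le _ _).trans (Finset.sum_le_sum fun m' _ => ?_)
        exact measure_biUnion_finset_le _ _
      · exact le_mul_of_one_le_left' (by exact_mod_cast (by omega : 1 ≤ A + N))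
    have hreal : ∑ m : Fin M, ∑ l ∈ Finset.range A,
        (receivedLaw Q star (κ.codeword m) l).real {y | κ.φ y ≠ m} ≤ M * (A * η.toReal) := by
      have h1 := ENNReal.toReal_mono (by finiteness) hsum
      rw [ENNReal.toReal_sum fun _ _ => ENNReal.sum_ne_top.2 fun _ _ => measure_ne_top _ _] at h1
      simp only [ENNReal.toReal_mul, ENNReal.toReal_natCast] at h1
      refine le_trans (le_of_eq ?_) h1
      refine Finset.sum_congr rfl fun m _ => ?_
      rw [ENNReal.toReal_sum fun _ _ => measure_ne_top _ _]
      rfl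
    have hM' : (0 : ℝ) < M := by exact_mod_cast hM
    have hA' : (0 : ℝ) < A := by exact_mod_cast hA
    calc κ.errorProb Q star A ≤ 1 / (A : ℝ) * (1 / (M : ℝ)) * (M * (A * η.toReal)) :=
          mul_le_mul_of_nonneg_left hreal (by positivity)
      _ = η.toReal := by field_simp
  · have hsum : ∑ m : Fin M, ∑ l ∈ Finset.range A,
        ∫⁻ y, ((κ.τ y - l : ℕ) : ENNReal) ∂(receivedLaw Q star (κ.codeword m) l) ≤
        M * (A * (N + η)) := by
      have h1 : ∑ _m : Fin M, ∑ _l ∈ Finset.range A, (N : ENNReal) = M * (A * N) := by simp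
      rw [mul_add, mul_add, ← h1]
      refine le_trans ?_ (add_le_add_right h _)
      rw [badWeight, ← Finset.sum_add_distrib]
      refine Finset.sum_le_sum fun m _ => ?_
      rw [← Finset.sum_add_distrib]
      refine Finset.sum_le_sum fun l _ => ?_
      rw [hκc]
      -- A measurable hull has the same measure and spares a measurability proof.
      set B := toMeasurable (receivedLaw Q star (c m) l) (acceptSet f θ (c m) l)ᶜ
      have hB : MeasurableSet B := measurableSet_toMeasurable _ _
      have hle : ∀ y, ((κ.τ y - l : ℕ) : ENNReal) ≤
          N + B.indicator (fun _ => ((A + N : ℕ) : ENNReal)) y := by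
        intro y
        by_cases hy : y ∈ acceptSet f θ (c m) l
        · have := hacc y m l hy
          refine le_trans ?_ le_self_add
          exact_mod_cast (by omega : κ.τ y - l ≤ N)
        · have hyB : y ∈ B := subset_toMeasurable _ _ hy
          rw [Set.indicator_of_mem hyB]
          refine le_trans ?_ le_add_self
          have := hκT y
          exact_mod_cast (by omega : κ.τ y - l ≤ A + N)
      refine (lintegral_mono hle).trans ?_
      rw [lintegral_add_left measurable_const, lintegral_indicator_const hB,
        measure_toMeasurable]
      simp only [lintegral_const, measure_univ, mul_one]
      exact add_le_add_right le_add_self _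
    calc κ.delay Q star A ≤ (A : ENNReal)⁻¹ * (M : ENNReal)⁻¹ * (M * (A * (N + η))) :=
          mul_le_mul_right hsum _
      _ = ((A : ENNReal)⁻¹ * A) * ((M : ENNReal)⁻¹ * M) * (N + η) := by ring
      _ = N + η := by
          rw [ENNReal.inv_mul_cancel hA0 hAt, ENNReal.inv_mul_cancel hM0 hMt, one_mul, one_mul]

/-! ### The Chernoff exponent -/

theorem sum_mul_densityRatio_rpow_eq {X Y : Type*} [Fintype X] [Fintype Y] (P : PMF X)
    (Q : X → PMF Y) (t : ℝ) :
    ∑ x, P x * ∑ y, Q x y * (densityRatio P Q x y : ENNReal) ^ (-t) =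
      ENNReal.ofReal (∑ x, ∑ y, (P x).toReal * (Q x y).toReal *
        Real.exp (-t * Real.log ((Q x y).toReal / outputProb P Q y))) := by
  rw [ENNReal.ofReal_sum_of_nonneg fun x _ => Finset.sum_nonneg fun y _ => by positivity]
  refine Finset.sum_congr rfl fun x _ => ?_
  rw [ENNReal.ofReal_sum_of_nonneg fun y _ => by positivity, Finset.mul_sum]
  refine Finset.sum_congr rfl fun y _ => ?_
  have hP : P x ≠ ⊤ := P.apply_ne_top x
  have hQ : Q x y ≠ ⊤ := (Q x).apply_ne_top y
  have hr : ∑ x', P x' * Q x' y = ENNReal.ofReal (outputProb P Q y) := by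
    rw [outputProb, ENNReal.ofReal_sum_of_nonneg fun x _ => by positivity]
    refine Finset.sum_congr rfl fun x' _ => ?_
    rw [← ENNReal.toReal_mul,
      ENNReal.ofReal_toReal (ENNReal.mul_ne_top (P.apply_ne_top x') ((Q x').apply_ne_top y))]
  by_cases hP0 : P x = 0
  · simp [hP0]
  by_cases hQ0 : Q x y = 0
  · simp [hQ0]
  have hp : 0 < (P x).toReal := ENNReal.toReal_pos hP0 hP
  have hq : 0 < (Q x y).toReal := ENNReal.toReal_pos hQ0 hQ
  have hrpos : 0 < outputProb P Q y :=
    (mul_pos hp hq).trans_le (Finset.single_le_sum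
      (f := fun x => (P x).toReal * (Q x y).toReal) (fun _ _ => by positivity)
      (Finset.mem_univ x))
  have hf : (densityRatio P Q x y : ENNReal) =
      ENNReal.ofReal ((Q x y).toReal / outputProb P Q y) := by
    rw [densityRatio, hr, ENNReal.ofReal_div_of_pos hrpos, ENNReal.ofReal_toReal hQ,
      ENNReal.coe_toNNReal]
    exact ENNReal.div_ne_top hQ (by simpa using hrpos)
  rw [hf, ENNReal.ofReal_rpow_of_pos (div_pos hq hrpos), Real.rpow_def_of_pos (div_pos hq hrpos),
    ENNReal.ofReal_mul (by positivity), ENNReal.ofReal_mul hp.le, ENNReal.ofReal_toReal hP,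
    ENNReal.ofReal_toReal hQ, mul_assoc, mul_comm (Real.log _)]

theorem sum_toReal_pmf_eq_one {X : Type*} [Fintype X] (P : PMF X) : ∑ x, (P x).toReal = 1 := by
  rw [← ENNReal.toReal_sum fun x _ => P.apply_ne_top x,
    ← tsum_fintype (L := SummationFilter.unconditional X), P.tsum_coe, ENNReal.toReal_one]

/-- The Chernoff factor, as a function `ψ` of `t`, equals `1` at `t = 0` and has derivative `γ -
I(PQ) < 0` there, so it drops below `1` for some small `t > 0`. -/
theorem exists_exponent_lt_one {X Y : Type*} [Fintype X] [Fintype Y] (P : PMF X) (Q : X → PMF Y)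
    {γ : ℝ} (hγ : γ < mutualInformation P Q) :
    ∃ t : ℝ, 0 < t ∧ ENNReal.ofReal (Real.exp γ) ^ t *
      ∑ x, P x * ∑ y, Q x y * (densityRatio P Q x y : ENNReal) ^ (-t) < 1 := by
  set k : X → Y → ℝ := fun x y => γ - Real.log ((Q x y).toReal / outputProb P Q y)
  set ψ : ℝ → ℝ := fun t => ∑ x, ∑ y, (P x).toReal * (Q x y).toReal * Real.exp (t * k x y)
  have hsum : ∑ x, ∑ y, (P x).toReal * (Q x y).toReal = 1 := by
    simp_rw [← Finset.mul_sum, sum_toReal_pmf_eq_one, mul_one, sum_toReal_pmf_eq_one]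
  have hψ0 : ψ 0 = 1 := by simpa [ψ] using hsum
  have hderiv : HasDerivAt ψ (γ - mutualInformation P Q) 0 := by
    have h : HasDerivAt ψ (∑ x, ∑ y, (P x).toReal * (Q x y).toReal *
        (Real.exp (0 * k x y) * (1 * k x y))) 0 :=
      HasDerivAt.fun_sum fun x _ => HasDerivAt.fun_sum fun y _ =>
        ((((hasDerivAt_id (0 : ℝ)).mul_const (k x y)).exp).const_mul _)
    convert h using 1
    simp only [zero_mul, Real.exp_zero, one_mul]
    simp only [k, mul_sub, Finset.sum_sub_distrib, ← Finset.sum_mul, hsum, one_mul,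
      mutualInformation]
  obtain ⟨t, ht, hψt⟩ : ∃ t : ℝ, 0 < t ∧ ψ t < 1 := by
    have h := hderiv.hasDerivWithinAt (s := Set.Ioi 0)
    rw [hasDerivWithinAt_iff_tendsto_slope' (by simp)] at h
    have hev := h.eventually (gt_mem_nhds (sub_neg.2 hγ))
    obtain ⟨t, hlt, ht⟩ := (hev.and self_mem_nhdsWithin).exists
    refine ⟨t, ht, ?_⟩
    have ht : 0 < t := ht
    rw [slope_def_field, sub_zero, div_lt_iff₀ ht, zero_mul, hψ0] at hlt
    linarith
  refine ⟨t, ht, ?_⟩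
  rw [sum_mul_densityRatio_rpow_eq, ENNReal.ofReal_rpow_of_pos (Real.exp_pos _),
    ← ENNReal.ofReal_mul (by positivity), ← ENNReal.ofReal_one]
  refine (ENNReal.ofReal_lt_ofReal_iff one_pos).2 (lt_of_eq_of_lt ?_ hψt)
  simp only [ψ, Finset.mul_sum]
  refine Finset.sum_congr rfl fun x _ => Finset.sum_congr rfl fun y _ => ?_
  rw [mul_left_comm, ← Real.exp_mul, ← Real.exp_add]
  congr 2
  simp only [k]
  ring

/-! ### Asymptotics of the error, the delay and the rate -/

/-- The second exponent allows `a < 0`, as occurs for `(α - ε) N` when `ε > α`: the ceiling is then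
`1`. -/
theorem natCeil_exp_le {a b : ℝ} (hb : 0 ≤ b) (hab : a ≤ b) :
    (⌈Real.exp a⌉₊ : ℝ) ≤ 2 * Real.exp b := by
  have h1 := (Nat.ceil_lt_add_one (Real.exp_pos a).le).le
  have h2 := Real.exp_le_exp.2 hab
  have h3 := Real.one_le_exp hb
  linarith

/-- A union bound with exponentially many terms against a larger exponent. -/
theorem union_bound_le {α β γ δ R : ℝ} (hα : 0 ≤ α) (hβ : β ≤ α) (hR : 0 ≤ R)
    (hγ : 2 * α ≤ γ - R) (hδ : 2 * α ≤ δ) {ρ : ENNReal} (hρ : ρ ≤ ENNReal.ofReal (Real.exp (-δ)))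
    (N : ℕ) :
    (⌈Real.exp (R * N)⌉₊ : ENNReal) * (⌈Real.exp (β * N)⌉₊ * (ENNReal.ofReal (Real.exp γ) ^ N)⁻¹) +
      (⌈Real.exp (β * N)⌉₊ + N : ℕ) * ρ ^ N ≤
    ENNReal.ofReal ((N + 6) * Real.exp (-(α * N))) := by
  have hN : (0 : ℝ) ≤ N := Nat.cast_nonneg N
  have hM := natCeil_exp_le (mul_nonneg hR hN) le_rfl
  have hA := natCeil_exp_le (mul_nonneg hα hN) (mul_le_mul_of_nonneg_right hβ hN)
  have h1 : (ENNReal.ofReal (Real.exp γ) ^ N)⁻¹ = ENNReal.ofReal (Real.exp (-(γ * N))) := by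
    rw [← ENNReal.ofReal_pow (Real.exp_pos _).le, ← ENNReal.ofReal_inv_of_pos (by positivity),
      ← Real.exp_nat_mul, ← Real.exp_neg, mul_comm]
  have h2 : ρ ^ N ≤ ENNReal.ofReal (Real.exp (-(δ * N))) := by
    refine (pow_le_pow_left' hρ N).trans (le_of_eq ?_)
    rw [← ENNReal.ofReal_pow (Real.exp_pos _).le, ← Real.exp_nat_mul]
    congr 2; ring
  rw [h1]
  refine (add_le_add_right (mul_le_mul_right h2 _) _).trans ?_
  rw [← ENNReal.ofReal_natCast, ← ENNReal.ofReal_natCast, ← ENNReal.ofReal_natCast,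
    ← ENNReal.ofReal_mul (by positivity), ← ENNReal.ofReal_mul (by positivity),
    ← ENNReal.ofReal_mul (by positivity), ← ENNReal.ofReal_add (by positivity) (by positivity)]
  refine ENNReal.ofReal_le_ofReal ?_
  push_cast
  have e1 : Real.exp (R * N) * (Real.exp (α * N) * Real.exp (-(γ * N))) ≤
      Real.exp (-(α * N)) := by
    rw [← Real.exp_add, ← Real.exp_add]
    exact Real.exp_le_exp.2 (by nlinarith)
  have e2 : Real.exp (α * N) * Real.exp (-(δ * N)) ≤ Real.exp (-(α * N)) := by
    rw [← Real.exp_add]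
    exact Real.exp_le_exp.2 (by nlinarith)
  have e3 : Real.exp (-(δ * N)) ≤ Real.exp (-(α * N)) := Real.exp_le_exp.2 (by nlinarith)
  calc (⌈Real.exp (R * N)⌉₊ : ℝ) * (⌈Real.exp (β * N)⌉₊ * Real.exp (-(γ * N))) +
        (⌈Real.exp (β * N)⌉₊ + N) * Real.exp (-(δ * N))
      ≤ (2 * Real.exp (R * N)) * ((2 * Real.exp (α * N)) * Real.exp (-(γ * N))) +
        (2 * Real.exp (α * N) + N) * Real.exp (-(δ * N)) := by gcongr
    _ = 4 * (Real.exp (R * N) * (Real.exp (α * N) * Real.exp (-(γ * N)))) +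
        2 * (Real.exp (α * N) * Real.exp (-(δ * N))) + N * Real.exp (-(δ * N)) := by ring
    _ ≤ 4 * Real.exp (-(α * N)) + 2 * Real.exp (-(α * N)) + N * Real.exp (-(α * N)) := by gcongr
    _ = (N + 6) * Real.exp (-(α * N)) := by ring

theorem tendsto_add_mul_exp_neg_zero {α : ℝ} (hα : 0 < α) :
    Filter.Tendsto (fun N : ℕ => ((N : ℝ) + 6) * Real.exp (-(α * N))) Filter.atTop (nhds 0) := by
  have h1 : Filter.Tendsto (fun x : ℝ => x ^ (1 : ℝ) * Real.exp (-α * x)) Filter.atTop (nhds 0) :=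
    tendsto_rpow_mul_exp_neg_mul_atTop_nhds_zero 1 α hα
  have h2 : Filter.Tendsto (fun x : ℝ => x ^ (0 : ℝ) * Real.exp (-α * x)) Filter.atTop (nhds 0) :=
    tendsto_rpow_mul_exp_neg_mul_atTop_nhds_zero 0 α hα
  have h3 := (h1.add (h2.const_mul 6)).comp tendsto_natCast_atTop_atTop
  simp only [mul_zero, add_zero] at h3
  refine h3.congr fun N => ?_
  simp only [Function.comp_apply, Real.rpow_one, Real.rpow_zero, neg_mul]
  ring

theorem ofReal_le_rate {X Y : Type*} [MeasurableSpace Y] {M N : ℕ} (κ : Code X Y M N)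
    (Q : X → PMF Y) (star : X) (A : ℕ) {R ε η : ℝ} (hR : 0 < R) (hε : 0 < ε) (hN : 0 < N)
    (hM : Real.exp (R * N) ≤ M) (hη : 0 ≤ η) (hη1 : η ≤ 1) (hNε : R / ε ≤ N)
    (hdelay : κ.delay Q star A ≤ N + ENNReal.ofReal η) :
    ENNReal.ofReal (R - ε) ≤ κ.rate Q star A := by
  have hN' : (0 : ℝ) < N := by exact_mod_cast hN
  have hlog : R * N ≤ Real.log M := (Real.le_log_iff_exp_le ((Real.exp_pos _).trans_le hM)).2 hM
  have hRN : 0 < R * N := mul_pos hR hN'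
  have hpos : ENNReal.ofReal (Real.log M) ≠ 0 := by
    simpa using hRN.trans_le hlog
  rw [Code.rate, ENNReal.le_div_iff_mul_le (Or.inr hpos) (Or.inr ENNReal.ofReal_ne_top)]
  rw [← ENNReal.ofReal_natCast, ← ENNReal.ofReal_add hN'.le hη] at hdelay
  refine (mul_le_mul_right hdelay _).trans ?_
  rw [← ENNReal.ofReal_mul' (by positivity)]
  refine ENNReal.ofReal_le_ofReal (le_trans ?_ hlog)
  rw [div_le_iff₀ hε] at hNε
  -- If `R ≤ ε` the left side is nonpositive; otherwise `(R - ε) η ≤ R ≤ ε N`.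
  rcases le_total R ε with h | h
  · nlinarith
  · nlinarith

end AsyncChannel

/-! ### Choice of the parameters -/

open AsyncChannel

theorem mainTheorem3 {X Y : Type*} [Fintype X] [Fintype Y]
    [MeasurableSpace Y] [DiscreteMeasurableSpace Y]
    (Q : X → PMF Y) (star : X) (hC : 0 < AsyncChannel.capacity Q)
    (R : ℝ) (hR : R ∈ Set.Ioo 0 (AsyncChannel.capacity Q)) :
    ∃ α : ℝ, 0 < α ∧ AsyncChannel.Achievable Q star α R := by
  obtain ⟨hR0, hRC⟩ := hR
  have : Nonempty (PMF X) := ⟨PMF.pure star⟩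
  obtain ⟨P, hP⟩ := exists_lt_of_lt_ciSup hRC
  obtain ⟨γ, hRγ, hγ⟩ := exists_between hP
  obtain ⟨t, ht, hρ⟩ := exists_exponent_lt_one P Q hγ
  set ρ := ENNReal.ofReal (Real.exp γ) ^ t *
    ∑ x, P x * ∑ y, Q x y * (densityRatio P Q x y : ENNReal) ^ (-t)
  obtain ⟨δ, hδ, hρδ⟩ : ∃ δ : ℝ, 0 < δ ∧ ρ ≤ ENNReal.ofReal (Real.exp (-δ)) := by
    obtain ⟨r, hρr, hr⟩ := ENNReal.lt_iff_exists_nnreal_btwn.1 hρ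
    have hr0 : (0 : ℝ) < r := by exact_mod_cast (zero_le (a := ρ)).trans_lt hρr
    have hr1 : (r : ℝ) < 1 := by exact_mod_cast hr
    refine ⟨-Real.log r, neg_pos.2 (Real.log_neg hr0 hr1), ?_⟩
    rw [neg_neg, Real.exp_log hr0, ENNReal.ofReal_coe_nnreal]
    exact hρr.le
  have hγR : 0 < γ - R := sub_pos.2 hRγ
  -- Half of each exponent gap pays for the factor `A`; the other half leaves the decay `e^{-αN}`.
  set α := min (γ - R) δ / 2 with hαdef
  have hα : 0 < α := half_pos (lt_min hγR hδ)
  have hα1 : 2 * α ≤ γ - R := by linarith [min_le_left (γ - R) δ]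
  have hα2 : 2 * α ≤ δ := by linarith [min_le_right (γ - R) δ]
  refine ⟨α, hα, fun ε hε => ?_⟩
  have hsmall := (tendsto_add_mul_exp_neg_zero hα).eventually_le_const (lt_min hε one_pos)
  have hlarge := tendsto_natCast_atTop_atTop.eventually_ge_atTop (R / ε)
  obtain ⟨N₀, hN₀⟩ := Filter.eventually_atTop.1
    (hsmall.and (hlarge.and (Filter.eventually_ge_atTop 1)))
  refine ⟨N₀, fun N hN => ?_⟩
  obtain ⟨hη, hNε, hN1⟩ := hN₀ N hN
  set η := ((N : ℝ) + 6) * Real.exp (-(α * N))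
  set A := ⌈Real.exp ((α - ε) * N)⌉₊
  set M := ⌈Real.exp (R * N)⌉₊
  have hη0 : 0 ≤ η := by positivity
  have hA0 : 0 < A := Nat.ceil_pos.2 (Real.exp_pos _)
  have hN' : (0 : ℝ) < N := by exact_mod_cast hN1
  -- `R N > 0` gives `e^{RN} > 1`, so its ceiling is at least `2`.
  have hM2 : 2 ≤ M := Nat.lt_ceil.2 (by simpa using mul_pos hR0 hN')
  obtain ⟨c, hc⟩ := exists_badWeight_le P Q star (θ := ENNReal.ofReal (Real.exp γ))
    (by simp [Real.exp_pos]) ENNReal.ofReal_ne_top ht M N A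
  have hbound := union_bound_le hα.le (sub_le_self α hε.le) hR0.le hα1 hα2 hρδ N
  obtain ⟨κ, herr, hdelay⟩ := exists_code_of_badWeight_le (by omega) hN1 hA0 Q star _ _ c
    (ENNReal.ofReal_ne_top (r := η))
    (hc.trans (mul_le_mul_right (mul_le_mul_right hbound _) _))
  refine ⟨M, hM2, κ, ?_, ?_⟩
  · exact ofReal_le_rate κ Q star A hR0 hε hN1 (Nat.le_ceil _) hη0
      (hη.trans (min_le_right _ _)) hNε hdelay
  · rw [ENNReal.toReal_ofReal hη0] at herr
    exact herr.trans (hη.trans (min_le_left _ _))
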